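/- Let $p$ be a prime, $k$ an algebraically closed field of characteristic $p$, $G$ a finite group and $P$ a normal $p$-subgroup of $G$ such that $p$ does not divide $|G/P\,C_G(P)|$. Let $M=\mathrm{Sc}(G,P)$ be the Scott $kG$-module with respect to $P$, i.e. the (up to isomorphism unique) indecomposable direct summand of $\mathrm{Ind}_P^G k_P$ which contains the trivial module $k_G$ in its top $M/\mathrm{rad}\,M$. Then $M$ is Brauer indecomposable: for every subgroup $Q\le P$, the restriction to $Q\,C_G(Q)$ of the $kN_G(Q)$-module $$M(Q)=M^Q\Big/\sum_{R<Q}\mathrm{tr}_R^Q(M^R)$$ is indecomposable or zero. Here, for a subgroup $R<Q$, $M^R$ denotes the space of $R$-fixed points of $M$, and $\mathrm{tr}_R^Q(m)=\sum_{h\in[Q/R]}hm$ for $m\in M^R$, where $[Q/R]$ is a set of representatives of the left cosets of $R$ in $Q$. -/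

import Mathlib

noncomputable section

namespace ScottBrauer

open scoped MonoidAlgebra

variable {k G V : Type*} [Field k] [Group G] [AddCommGroup V] [Module k V]

/-- Restriction `Res^G_H M` of a representation to a subgroup. -/
abbrev res (ρ : Representation k G V) (H : Subgroup G) : Representation k H V :=
  ρ.comp H.subtype

/-- A representation (a `kG`-module) is indecomposable if it is nonzero and is not the direct sum
of two nonzero submodules. -/
def IsIndecomposable (ρ : Representation k G V) : Prop :=
  Nontrivial V ∧ ∀ W₁ W₂ : Subrepresentation ρ, IsCompl W₁ W₂ → W₁ = ⊥ ∨ W₂ = ⊥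

/-- `L ∣ M`: the representation `ρ` is isomorphic to a direct summand of `σ`. -/
def IsDirectSummand {W : Type*} [AddCommGroup W] [Module k W]
    (ρ : Representation k G V) (σ : Representation k G W) : Prop :=
  ∃ W₁ W₂ : Subrepresentation σ, IsCompl W₁ W₂ ∧ Nonempty (ρ.Equiv W₁.toRepresentation)

/-- The trivial module `k_G` is contained in the top `M / rad M` of `M`, where `rad M` is the
intersection of the maximal submodules of `M`. -/
def TrivialInTop (ρ : Representation k G V) : Prop :=
  ∃ f : (Representation.trivial k G k).asModule →ₗ[k[G]]
      (ρ.asModule ⧸ Module.jacobson k[G] ρ.asModule), Function.Injective f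

/-- `ρ` is (a model of) the Scott module `Sc(G,H)`: an indecomposable direct summand of
`Ind_H^G k_H` which has the trivial module `k_G` in its top. -/
structure IsScottModule (ρ : Representation k G V) (H : Subgroup G) : Prop where
  isIndecomposable : IsIndecomposable ρ
  isDirectSummand :
    IsDirectSummand ρ (Representation.ind H.subtype (Representation.trivial k H k))
  trivialInTop : TrivialInTop ρ

/-- The fixed points `M^K` of a subgroup `K`. -/
abbrev fixed (ρ : Representation k G V) (K : Subgroup G) : Submodule k V :=
  (res ρ K).invariants

/-- On `M^K`, the action of an element `x` of `H` depends only on its coset `xK`. -/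
lemma out_apply (ρ : Representation k G V) (K H : Subgroup G) {m : V} (hm : m ∈ fixed ρ K)
    (x : H) : ρ (((x : H ⧸ K.subgroupOf H).out : H) : G) m = ρ (x : G) m := by
  obtain ⟨h, hh⟩ := QuotientGroup.mk_out_eq_mul (K.subgroupOf H) x
  have h1 : ρ ((h : H) : G) m = m := hm ⟨((h : H) : G), h.2⟩
  rw [hh, Subgroup.coe_mul, map_mul, Module.End.mul_apply, h1]

/-- The relative trace map `tr_K^H : M^K → M^H`, `m ↦ ∑_{h ∈ [H/K]} h m`, the sum being over
representatives of the left cosets of `K` in `H` (it is used for `K ≤ H`). -/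
def relTrace [Finite G] (ρ : Representation k G V) (K H : Subgroup G) :
    fixed ρ K →ₗ[k] fixed ρ H where
  toFun m := ⟨∑ᶠ h : H ⧸ K.subgroupOf H, ρ ((h.out : H) : G) (m : V), fun x => by
    change ρ (x : G) _ = _
    rw [map_finsum _ (Set.toFinite _)]
    conv_rhs => rw [← finsum_comp_equiv (MulAction.toPerm x : Equiv.Perm (H ⧸ K.subgroupOf H))]
    refine finsum_congr fun q => ?_
    have hq : x • q = ((x * q.out : H) : H ⧸ K.subgroupOf H) := by
      conv_lhs => rw [← q.out_eq]
      rfl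
    rw [MulAction.toPerm_apply, hq, out_apply ρ K H m.2]
    simp⟩
  map_add' a b := by
    ext
    simp only [Submodule.coe_add, map_add]
    exact finsum_add_distrib (Set.toFinite _) (Set.toFinite _)
  map_smul' c a := by
    ext
    simp only [Submodule.coe_smul, map_smul, RingHom.id_apply]
    exact (smul_finsum c _).symm

/-- The submodule `∑_{K < Q} tr_K^Q (M^K)` of `M^Q`. -/
def traceSum [Finite G] (ρ : Representation k G V) (Q : Subgroup G) :
    Submodule k (fixed ρ Q) :=
  ⨆ (K : Subgroup G) (_ : K < Q), LinearMap.range (relTrace ρ K Q)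

lemma fixed_stable (ρ : Representation k G V) (Q : Subgroup G)
    (n : Subgroup.normalizer (Q : Set G)) : fixed ρ Q ≤ (fixed ρ Q).comap (res ρ _ n) := by
  intro m hm x
  have h1 : (n : G)⁻¹ * x * n ∈ Q := by
    have := (Subgroup.mem_normalizer_iff.1 (inv_mem n.2) (x : G)).1 x.2
    simpa using this
  have h2 : ρ ((n : G)⁻¹ * x * n) m = m := hm ⟨_, h1⟩
  change ρ (x : G) (ρ (n : G) m) = ρ (n : G) m
  conv_rhs => rw [← h2]
  rw [← Module.End.mul_apply, ← Module.End.mul_apply, ← map_mul, ← map_mul]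
  congr 2
  group

/-- `M^Q` as a representation of `N_G(Q)`. -/
def fixedRep (ρ : Representation k G V) (Q : Subgroup G) :
    Representation k (Subgroup.normalizer (Q : Set G)) (fixed ρ Q) :=
  (res ρ (Subgroup.normalizer (Q : Set G))).subrepresentation (fixed ρ Q) (fixed_stable ρ Q)

lemma traceSum_stable [Finite G] (ρ : Representation k G V) (Q : Subgroup G)
    (n : Subgroup.normalizer (Q : Set G)) :
    traceSum ρ Q ≤ (traceSum ρ Q).comap (fixedRep ρ Q n) := by
  refine iSup₂_le fun K hK => ?_
  rintro _ ⟨m, rfl⟩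
  have hn : ∀ h : G, h ∈ Q ↔ (n : G) * h * (n : G)⁻¹ ∈ Q := Subgroup.mem_normalizer_iff.1 n.2
  let K' : Subgroup G := K.map (MulAut.conj (n : G)).toMonoidHom
  have hmem : ∀ y : G, (n : G) * y * (n : G)⁻¹ ∈ K' ↔ y ∈ K := fun y =>
    Subgroup.mem_map_iff_mem (f := (MulAut.conj (n : G)).toMonoidHom) (MulAut.conj (n : G)).injective
  have hsurj : ∀ y : G, y = (n : G) * ((n : G)⁻¹ * y * n) * (n : G)⁻¹ := fun y => by group
  have hK' : K' < Q := by
    refine lt_of_le_not_ge ?_ fun hle => hK.not_ge fun y hy => ?_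
    · rintro _ ⟨y, hy, rfl⟩
      exact (hn y).1 (hK.le hy)
    · exact (hmem y).1 (hle ((hn y).1 hy))
  have hm' : ρ (n : G) (m : V) ∈ fixed ρ K' := by
    rintro ⟨x, y, hy, rfl⟩
    have h2 : ρ y (m : V) = m := m.2 ⟨y, hy⟩
    change ρ ((n : G) * y * (n : G)⁻¹) (ρ (n : G) (m : V)) = ρ (n : G) (m : V)
    conv_rhs => rw [← h2]
    rw [← Module.End.mul_apply, ← Module.End.mul_apply, ← map_mul, ← map_mul]
    congr 2
    group
  let e : Q ≃ Q :=
    { toFun := fun x => ⟨(n : G) * x * (n : G)⁻¹, (hn x).1 x.2⟩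
      invFun := fun x => ⟨(n : G)⁻¹ * x * n, (hn _).2 (by rw [← hsurj]; exact x.2)⟩
      left_inv := fun x => by ext; simp [mul_assoc]
      right_inv := fun x => by ext; simp [mul_assoc] }
  let E : (Q ⧸ K.subgroupOf Q) ≃ (Q ⧸ K'.subgroupOf Q) := Quotient.congr e fun a b => by
    change QuotientGroup.leftRel _ a b ↔ QuotientGroup.leftRel _ (e a) (e b)
    rw [QuotientGroup.leftRel_apply, QuotientGroup.leftRel_apply, Subgroup.mem_subgroupOf,
      Subgroup.mem_subgroupOf, ← hmem]
    have : (n : G) * ((a⁻¹ * b : Q) : G) * (n : G)⁻¹ = (((e a)⁻¹ * e b : Q) : G) := by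
      simp [e, mul_assoc]
    rw [this]
  have key : fixedRep ρ Q n (relTrace ρ K Q m) = relTrace ρ K' Q ⟨_, hm'⟩ := by
    ext
    change ρ (n : G) (∑ᶠ h : Q ⧸ K.subgroupOf Q, ρ ((h.out : Q) : G) (m : V)) =
      ∑ᶠ h : Q ⧸ K'.subgroupOf Q, ρ ((h.out : Q) : G) (ρ (n : G) (m : V))
    rw [map_finsum _ (Set.toFinite _), ← finsum_comp_equiv E]
    refine finsum_congr fun q => ?_
    have hq : E q = ((e q.out : Q) : Q ⧸ K'.subgroupOf Q) := by
      conv_lhs => rw [← q.out_eq]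
      rfl
    rw [hq, out_apply ρ K' Q hm', ← Module.End.mul_apply, ← Module.End.mul_apply, ← map_mul,
      ← map_mul]
    congr 2
    simp [e]
  rw [Submodule.mem_comap, key]
  exact Submodule.mem_iSup_of_mem K' (Submodule.mem_iSup_of_mem hK' ⟨_, rfl⟩)

/-- The Brauer construction `M(Q) = M^Q / ∑_{K < Q} tr_K^Q (M^K)` as a representation of
`N_G(Q)`. -/
def brauer [Finite G] (ρ : Representation k G V) (Q : Subgroup G) :
    Representation k (Subgroup.normalizer (Q : Set G)) (fixed ρ Q ⧸ traceSum ρ Q) :=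
  (fixedRep ρ Q).quotient (traceSum ρ Q) (traceSum_stable ρ Q)

/-- `Q C_G(Q)` is contained in `N_G(Q)`. -/
lemma mul_centralizer_le_normalizer (Q : Subgroup G) :
    Q ⊔ Subgroup.centralizer (Q : Set G) ≤ Subgroup.normalizer (Q : Set G) := by
  refine sup_le Subgroup.le_normalizer fun g hg => Subgroup.mem_normalizer_iff.2 fun h => ?_
  rw [Subgroup.mem_centralizer_iff] at hg
  constructor
  · intro hh
    rw [← hg h hh, mul_inv_cancel_right]
    exact hh
  · intro hh
    have h1 := hg _ hh
    have h2 : h = g * h * g⁻¹ := by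
      have h3 : g * h = g * (g * h * g⁻¹) := by rw [← h1]; group
      exact mul_left_cancel h3
    rw [h2]
    exact hh

/-- `M` is Brauer indecomposable with respect to `P`: for every subgroup `Q` of `P`, the
restriction of `M(Q)` to `Q C_G(Q)` is indecomposable or zero. -/
def IsBrauerIndecomposable [Finite G] (ρ : Representation k G V) (P : Subgroup G) : Prop :=
  ∀ Q : Subgroup G, Q ≤ P →
    IsIndecomposable
        ((brauer ρ Q).comp (Subgroup.inclusion (mul_centralizer_le_normalizer Q))) ∨
      Subsingleton (fixed ρ Q ⧸ traceSum ρ Q)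

end ScottBrauer

end

noncomputable section

namespace ScottBrauer

open scoped MonoidAlgebra

variable {k G V : Type*} [Field k] [Group G] [AddCommGroup V] [Module k V]

/-! ### The permutation module induced from a normal subgroup, and Frobenius reciprocity. -/

section Induced

variable (P : Subgroup G)

/-! Since `P` is normal, it acts trivially on `Ind_P^G k_P`, hence on `M`. For `Q ≤ P` every trace
from a proper subgroup of `Q` is then multiplication by a nontrivial power of `p`, so `M(Q)` is `M`
itself. An element of `P C_G(P)` acts on `M` through its factor in `C_G(P) ≤ C_G(Q)`, so it suffices
that the restriction of `M` to `H = P C_G(P)` be indecomposable.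

The module `M` has a nonzero invariant linear form `π`. Frobenius reciprocity and Fitting's lemma
show that `ker π` contains every proper submodule (`IsScottModule.eq_top_of_apply_ne_zero`); in
effect, `M` is the projective cover of `k` over `k[G/P]`. As `|G : H|` is invertible in `k`,
averaging over `G/H` shows that `ker π` lies in the radical of the restriction to `H`
(`kerForm_le_radical_res`). So that restriction has a unique maximal submodule and cannot decompose.
-/

lemma indV_mk_mul_left (x : P) (g : G) :
    Representation.IndV.mk P.subtype (Representation.trivial k P k) (x * g) 1 =
      Representation.IndV.mk P.subtype (Representation.trivial k P k) g 1 := by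
  have := Representation.Coinvariants.mk_self_apply
    (Representation.tprod ((Representation.leftRegular k G).comp P.subtype)
      (Representation.trivial k P k)) x (TensorProduct.tmul k (MonoidAlgebra.single g 1) 1)
  simpa using this

/-- A normal subgroup `P` acts trivially on `Ind_P^G k_P`. -/
lemma ind_trivial_apply_of_mem [P.Normal] {x : G} (hx : x ∈ P) :
    Representation.ind P.subtype (Representation.trivial k P k) x = 1 := by
  refine Representation.IndV.hom_ext _ _ fun g => LinearMap.ext_ring ?_
  -- The element `x` sends the generator at `g` to the one at `g * x⁻¹ = (g * x⁻¹ * g⁻¹) * g`, and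
  -- the bracket, lying in `P`, is absorbed on the left.
  have hc : g * x⁻¹ * g⁻¹ ∈ P := Subgroup.Normal.conj_mem ‹_› _ (inv_mem hx) g
  have := indV_mk_mul_left (k := k) P ⟨_, hc⟩ g
  simp only [inv_mul_cancel_right] at this
  rw [LinearMap.comp_apply, Representation.ind_mk, this]
  rfl

/-- Frobenius reciprocity: a `P`-fixed vector `n` of a representation of `G` determines a
homomorphism from `Ind_P^G k_P`. -/
def indTrivialLift (ρ : Representation k G V) (n : V) (hn : ∀ x ∈ P, ρ x n = n) :
    (Representation.ind P.subtype (Representation.trivial k P k)).IntertwiningMap ρ where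
  toLinearMap := Representation.Coinvariants.lift _
    (TensorProduct.lift <| (Finsupp.lift _ _ _ fun h => ρ h⁻¹ ∘ₗ LinearMap.toSpanSingleton k V n) ∘ₗ
      (MonoidAlgebra.coeffLinearEquiv k).toLinearMap)
    fun g => by
      ext h
      have : ρ (g : G)⁻¹ n = n := hn _ (inv_mem g.2)
      simp [this]
  isIntertwining' g := by ext; simp

lemma indTrivialLift_mk (ρ : Representation k G V) (n : V) (hn : ∀ x ∈ P, ρ x n = n) (g : G) :
    indTrivialLift P ρ n hn (Representation.IndV.mk P.subtype (Representation.trivial k P k) g 1) =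
      ρ g⁻¹ n := by
  rw [← Representation.IntertwiningMap.toLinearMap_apply]
  simp [indTrivialLift]

instance [Finite G] : FiniteDimensional k
    (Representation.IndV P.subtype (Representation.trivial k P k)) := by
  have : Module.Finite k k[G] :=
    Module.Finite.equiv (MonoidAlgebra.coeffLinearEquiv k (M := G) (S := k)).symm
  exact Module.Finite.of_surjective _ (Submodule.mkQ_surjective _)

end Induced

/-! ### Direct summands, Fitting's lemma, and the maximal submodule of the Scott module. -/

/-- A direct summand is a retract. -/
lemma IsDirectSummand.exists_retract {W : Type*} [AddCommGroup W] [Module k W]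
    {ρ : Representation k G V} {σ : Representation k G W} (h : IsDirectSummand ρ σ) :
    ∃ (i : ρ.IntertwiningMap σ) (r : σ.IntertwiningMap ρ), ∀ v, r (i v) = v := by
  obtain ⟨W₁, W₂, hW, ⟨e⟩⟩ := h
  have hc : IsCompl W₁.toSubmodule W₂.toSubmodule := by
    refine IsCompl.of_eq ?_ ?_
    · exact congrArg Subrepresentation.toSubmodule hW.inf_eq_bot
    · exact congrArg Subrepresentation.toSubmodule hW.sup_eq_top
  let π := Submodule.projectionOnto _ _ hc
  have hπ : ∀ g w, π (σ g w) = W₁.toRepresentation g (π w) := by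
    intro g w
    obtain ⟨a, ha, b, hb, rfl⟩ : ∃ a ∈ W₁.toSubmodule, ∃ b ∈ W₂.toSubmodule, a + b = w :=
      Submodule.mem_sup.1 (hc.sup_eq_top ▸ Submodule.mem_top)
    have h1 : π a = ⟨a, ha⟩ := Submodule.projectionOnto_apply_left hc ⟨a, ha⟩
    have h2 : π b = 0 := Submodule.projectionOnto_apply_right hc ⟨b, hb⟩
    have h3 : π (σ g a) = ⟨σ g a, W₁.apply_mem_toSubmodule g ha⟩ :=
      Submodule.projectionOnto_apply_left hc ⟨σ g a, W₁.apply_mem_toSubmodule g ha⟩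
    have h4 : π (σ g b) = 0 :=
      Submodule.projectionOnto_apply_right hc ⟨σ g b, W₂.apply_mem_toSubmodule g hb⟩
    rw [map_add, map_add, map_add, h1, h2, h3, h4, add_zero, add_zero]
    rfl
  refine ⟨⟨W₁.toSubmodule.subtype ∘ₗ e.toLinearEquiv.toLinearMap, fun g => ?_⟩,
    ⟨e.toLinearEquiv.symm.toLinearMap ∘ₗ π, fun g => ?_⟩, fun v => ?_⟩
  · ext v
    exact congrArg Subtype.val (e.toIntertwiningMap.isIntertwining _ _ g v)
  · ext w
    change e.toLinearEquiv.symm (π (σ g w)) = ρ g (e.toLinearEquiv.symm (π w))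
    rw [hπ, LinearEquiv.symm_apply_eq]
    refine Eq.trans ?_ (e.toIntertwiningMap.isIntertwining _ _ g (e.toLinearEquiv.symm (π w))).symm
    exact congrArg _ (e.toLinearEquiv.apply_symm_apply (π w)).symm
  · change e.toLinearEquiv.symm (π (e.toLinearEquiv v)) = v
    rw [LinearEquiv.symm_apply_eq]
    exact Submodule.projectionOnto_apply_left hc _

lemma finiteDimensional_of_isDirectSummand {W : Type*} [AddCommGroup W] [Module k W]
    [FiniteDimensional k W] {ρ : Representation k G V} {σ : Representation k G W}
    (h : IsDirectSummand ρ σ) : FiniteDimensional k V := by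
  obtain ⟨i, r, hr⟩ := h.exists_retract
  exact Module.Finite.of_surjective r.toLinearMap fun v => ⟨i v, hr v⟩

/-- A normal subgroup `P` acts trivially on the direct summands of `Ind_P^G k_P`. -/
lemma IsDirectSummand.apply_eq_self {P : Subgroup G} [P.Normal] {ρ : Representation k G V}
    (h : IsDirectSummand ρ (Representation.ind P.subtype (Representation.trivial k P k)))
    {x : G} (hx : x ∈ P) (v : V) : ρ x v = v := by
  obtain ⟨i, r, hr⟩ := h.exists_retract
  have h1 := i.isIntertwining _ _ x v
  rw [ind_trivial_apply_of_mem P hx, Module.End.one_apply] at h1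
  rw [← hr (ρ x v), h1, hr]

/-- Fitting's lemma: an endomorphism of an indecomposable representation which does not change a
nonzero linear form is surjective. -/
lemma IsIndecomposable.surjective_of_comp_eq [FiniteDimensional k V] {ρ : Representation k G V}
    (h : IsIndecomposable ρ) (f : ρ.IntertwiningMap ρ) {π : V →ₗ[k] k} (hπ : π ≠ 0)
    (hf : ∀ v, π (f v) = π v) : Function.Surjective f := by
  -- For large `n` the space is the direct sum of `ker f^n` and `range f^n`; `n ≥ 1` ensures `ker f
  -- ≤ ker f^n`.
  obtain ⟨n, hn, hn1⟩ := ((LinearMap.eventually_isCompl_ker_pow_range_pow f.toLinearMap).and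
    (Filter.eventually_ge_atTop 1)).exists
  have hcomm : ∀ (m : ℕ) (g : G) (v : V), (f.toLinearMap ^ m) (ρ g v) =
      ρ g ((f.toLinearMap ^ m) v) := by
    intro m g
    induction m with
    | zero => intro v; rfl
    | succ m ih =>
      intro v
      rw [pow_succ', Module.End.mul_apply, Module.End.mul_apply, ih]
      exact f.isIntertwining _ _ g _
  have hpow : ∀ (m : ℕ) (v : V), π ((f.toLinearMap ^ m) v) = π v := by
    intro m
    induction m with
    | zero => intro v; rfl
    | succ m ih =>
      intro v
      rw [pow_succ', Module.End.mul_apply, ← ih v]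
      exact hf _
  let W₁ : Subrepresentation ρ := ⟨LinearMap.ker (f.toLinearMap ^ n), fun g v hv => by
    rw [LinearMap.mem_ker] at hv ⊢
    rw [hcomm, hv, map_zero]⟩
  let W₂ : Subrepresentation ρ := ⟨LinearMap.range (f.toLinearMap ^ n), fun g v hv => by
    obtain ⟨w, rfl⟩ := hv
    exact ⟨ρ g w, hcomm n g w⟩⟩
  have hW : IsCompl W₁ W₂ := IsCompl.of_eq
    (Subrepresentation.toSubmodule_injective hn.inf_eq_bot)
    (Subrepresentation.toSubmodule_injective hn.sup_eq_top)
  rcases h.2 W₁ W₂ hW with h1 | h2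
  · have h3 : LinearMap.ker (f.toLinearMap ^ n) = ⊥ :=
      congrArg Subrepresentation.toSubmodule h1
    have h4 : LinearMap.ker f.toLinearMap = ⊥ := by
      rw [eq_bot_iff, ← h3]
      intro v hv
      obtain ⟨m, rfl⟩ := Nat.exists_eq_add_of_le' hn1
      rw [LinearMap.mem_ker] at hv ⊢
      rw [pow_succ, Module.End.mul_apply, hv, map_zero]
    exact LinearMap.injective_iff_surjective.1 (LinearMap.ker_eq_bot.1 h4)
  -- A nilpotent `f` is excluded: `π ∘ f^n = π` would force `π = 0`.
  · have h3 : LinearMap.range (f.toLinearMap ^ n) = ⊥ :=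
      congrArg Subrepresentation.toSubmodule h2
    refine absurd (LinearMap.ext fun v => ?_) hπ
    have h4 : (f.toLinearMap ^ n) v = 0 := by
      rw [← LinearMap.mem_range.2 ⟨v, rfl⟩ |> fun h => (Submodule.mem_bot k).1 (h3 ▸ h)]
    rw [← hpow n v, h4, map_zero, LinearMap.zero_apply]

/-- For `P` normal, the kernel of an invariant linear form on the Scott module of `P` contains all
proper submodules. -/
lemma IsScottModule.eq_top_of_apply_ne_zero [FiniteDimensional k V] {P : Subgroup G} [P.Normal]
    {ρ : Representation k G V} (h : IsScottModule ρ P) {π : V →ₗ[k] k}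
    (hπ : ∀ g v, π (ρ g v) = π v) (N : Subrepresentation ρ) {n : V} (hn : n ∈ N) (hn0 : π n ≠ 0) :
    N = ⊤ := by
  obtain ⟨i, r, hr⟩ := h.isDirectSummand.exists_retract
  -- The retraction `r` is determined by `u`. Rescaling `n` to `m` with `π m = π u` gives a map `F`
  -- from the induced module into `N` with `π ∘ F = π ∘ r`, so that `F ∘ i` preserves `π`.
  let u := r (Representation.IndV.mk P.subtype (Representation.trivial k P k) 1 1)
  let m := (π u * (π n)⁻¹) • n
  have hm : π m = π u := by simp [m, hn0]
  let F := indTrivialLift P ρ m fun x hx => h.isDirectSummand.apply_eq_self hx m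
  have hFπ : π ∘ₗ F.toLinearMap = π ∘ₗ r.toLinearMap := by
    refine Representation.IndV.hom_ext _ _ fun g => LinearMap.ext_ring ?_
    change π (F _) = π (r _)
    rw [indTrivialLift_mk, hπ, hm, ← hπ g⁻¹ u]
    rw [← r.isIntertwining, Representation.ind_mk, inv_inv, one_mul]
  have hFN : ∀ w, F w ∈ N := by
    intro w
    have : N.toSubmodule.mkQ ∘ₗ F.toLinearMap = 0 := by
      refine Representation.IndV.hom_ext _ _ fun g => LinearMap.ext_ring ?_
      change N.toSubmodule.mkQ (F _) = 0
      rw [indTrivialLift_mk, Submodule.mkQ_apply, Submodule.Quotient.mk_eq_zero]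
      exact N.apply_mem_toSubmodule _ (N.toSubmodule.smul_mem _ hn)
    exact (Submodule.Quotient.mk_eq_zero N.toSubmodule).1 (LinearMap.congr_fun this w)
  have hsurj := h.isIndecomposable.surjective_of_comp_eq (F.comp i)
    (π := π) (fun h0 => hn0 (by rw [h0, LinearMap.zero_apply])) fun v => by
      conv_rhs => rw [← hr v]
      exact LinearMap.congr_fun hFπ (i v)
  refine top_le_iff.1 fun v _ => ?_
  obtain ⟨w, rfl⟩ := hsurj v
  exact hFN _

/-! ### The radical and the top of a representation. -/

lemma isArtinian_asModule [FiniteDimensional k V] (ρ : Representation k G V) :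
    IsArtinian k[G] ρ.asModule :=
  isArtinian_of_tower k inferInstance

lemma isCoatomic_subrepresentation [FiniteDimensional k V] (ρ : Representation k G V) :
    IsCoatomic (Subrepresentation ρ) := by
  have : IsNoetherian k[G] ρ.asModule := isNoetherian_of_tower k inferInstance
  exact Subrepresentation.subrepresentationSubmoduleOrderIso.isCoatomic_iff.2 inferInstance

lemma isSemisimpleModule_quotient_jacobson [FiniteDimensional k V] (ρ : Representation k G V) :
    IsSemisimpleModule k[G] (ρ.asModule ⧸ Module.jacobson k[G] ρ.asModule) := by
  have := isArtinian_asModule ρ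
  exact IsArtinian.isSemisimpleModule_iff_jacobson _ _ |>.2
    (Module.jacobson_quotient_jacobson _ _)

/-- If `k_G` is contained in the top of `M`, then it is a quotient of `M`. -/
lemma TrivialInTop.exists_linearForm [FiniteDimensional k V] {ρ : Representation k G V}
    (h : TrivialInTop ρ) : ∃ π : V →ₗ[k] k, π ≠ 0 ∧ ∀ g v, π (ρ g v) = π v := by
  obtain ⟨f, hf⟩ := h
  have := isSemisimpleModule_quotient_jacobson ρ
  -- The top is semisimple, so the embedding of `k_G` into it splits.
  obtain ⟨r, hr⟩ := IsSemisimpleModule.extension_property f hf LinearMap.id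
  let F : ρ.asModule →ₗ[k[G]] (Representation.trivial k G k).asModule :=
    r ∘ₗ (Module.jacobson k[G] ρ.asModule).mkQ
  let π : V →ₗ[k] k := (Representation.trivial k G k).asModuleEquiv.toLinearMap ∘ₗ
    F.restrictScalars k ∘ₗ ρ.asModuleEquiv.symm.toLinearMap
  refine ⟨π, fun h0 => ?_, fun g v => ?_⟩
  · obtain ⟨v, hv⟩ := Submodule.mkQ_surjective (Module.jacobson k[G] ρ.asModule)
      (f ((Representation.trivial k G k).asModuleEquiv.symm 1))
    have h1 : F v = (Representation.trivial k G k).asModuleEquiv.symm 1 := by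
      change r _ = _
      rw [hv]
      exact LinearMap.congr_fun hr _
    have h2 : π (ρ.asModuleEquiv v) = 1 := by simp [π, h1]
    rw [h0] at h2
    exact zero_ne_one h2
  · change (Representation.trivial k G k).asModuleEquiv (F (ρ.asModuleEquiv.symm (ρ g v))) =
      (Representation.trivial k G k).asModuleEquiv (F (ρ.asModuleEquiv.symm v))
    rw [Representation.asModuleEquiv_symm_map_rho, map_smul,
      Representation.asModuleEquiv_map_smul]
    simp

/-- The radical of a representation, as a subrepresentation. -/
def radical (ρ : Representation k G V) : Subrepresentation ρ :=
  Subrepresentation.subrepresentationSubmoduleOrderIso.symm (Module.jacobson k[G] ρ.asModule)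

lemma mem_radical {ρ : Representation k G V} {v : V} :
    v ∈ radical ρ ↔ ∀ N : Subrepresentation ρ, IsCoatom N → v ∈ N := by
  refine Iff.trans (Submodule.mem_sInf (M := ρ.asModule)) ?_
  constructor
  · intro h N hN
    exact h (Subrepresentation.subrepresentationSubmoduleOrderIso N)
      ((OrderIso.isCoatom_iff _ _).2 hN)
  · intro h N hN
    exact h (Subrepresentation.subrepresentationSubmoduleOrderIso.symm N)
      ((OrderIso.isCoatom_iff _ _).2 hN)

lemma radical_le {ρ : Representation k G V} {N : Subrepresentation ρ} (hN : IsCoatom N) :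
    radical ρ ≤ N := fun _ hv => mem_radical.1 hv N hN

/-- Every subrepresentation containing the radical has a complement modulo the radical. -/
lemma exists_complement_mod_radical [FiniteDimensional k V] {ρ : Representation k G V}
    {N : Subrepresentation ρ} (hN : radical ρ ≤ N) :
    ∃ C : Subrepresentation ρ, N ⊓ C = radical ρ ∧ N ⊔ C = ⊤ := by
  have := isSemisimpleModule_quotient_jacobson ρ
  let J := Module.jacobson k[G] ρ.asModule
  let e : Subrepresentation ρ ≃o Submodule k[G] ρ.asModule :=
    Subrepresentation.subrepresentationSubmoduleOrderIso
  have hJ : J ≤ e N := hN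
  obtain ⟨D, hD⟩ := exists_isCompl ((e N).map J.mkQ)
  have h1 : ((e N).map J.mkQ).comap J.mkQ = e N := by
    rw [Submodule.comap_map_mkQ, sup_eq_right.2 hJ]
  refine ⟨e.symm (D.comap J.mkQ), e.injective ?_, e.injective ?_⟩
  · rw [map_inf, OrderIso.apply_symm_apply, ← h1, ← Submodule.comap_inf, hD.inf_eq_bot,
      Submodule.comap_bot, Submodule.ker_mkQ]
    rfl
  · rw [map_sup, OrderIso.apply_symm_apply, map_top]
    refine top_le_iff.1 fun v _ => ?_
    have hv : J.mkQ v ∈ (e N).map J.mkQ ⊔ D := hD.sup_eq_top ▸ Submodule.mem_top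
    obtain ⟨_, ⟨a, ha, rfl⟩, d, hd, hs⟩ := Submodule.mem_sup.1 hv
    refine Submodule.mem_sup.2 ⟨a, ha, v - a, ?_, add_sub_cancel _ _⟩
    change J.mkQ (v - a) ∈ D
    rw [map_sub, ← hs, add_sub_cancel_left]
    exact hd

/-! ### Restriction to a normal subgroup of invertible index. -/

/-- The translation by `g` of the `H`-stable subspaces, for a normal subgroup `H`. -/
def translateIso (ρ : Representation k G V) (H : Subgroup G) [hH : H.Normal] (g : G) :
    Subrepresentation (res ρ H) ≃o Subrepresentation (res ρ H) :=
  let T (x : G) (N : Subrepresentation (res ρ H)) : Subrepresentation (res ρ H) :=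
    ⟨N.toSubmodule.comap (ρ x), fun h v hv => by
      have h1 := N.apply_mem_toSubmodule ⟨x * h * x⁻¹, hH.conj_mem _ h.2 x⟩ hv
      have h2 : ρ (x * h * x⁻¹) (ρ x v) = ρ x (ρ (h : G) v) := by
        rw [← Module.End.mul_apply, ← Module.End.mul_apply, ← map_mul, ← map_mul,
          inv_mul_cancel_right]
      change ρ x (ρ (h : G) v) ∈ N.toSubmodule
      rw [← h2]
      exact h1⟩
  have hT (x : G) (N) : T x⁻¹ (T x N) = N := by
    refine SetLike.ext fun v => ?_
    change ρ x (ρ x⁻¹ v) ∈ N ↔ v ∈ N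
    rw [Representation.self_inv_apply]
  have hT' (x : G) (N) : T x (T x⁻¹ N) = N := by
    refine SetLike.ext fun v => ?_
    change ρ x⁻¹ (ρ x v) ∈ N ↔ v ∈ N
    rw [Representation.inv_self_apply]
  { toFun := T g
    invFun := T g⁻¹
    left_inv := hT g
    right_inv := hT' g
    map_rel_iff' := by
      intro N N'
      refine ⟨fun h v hv => ?_, fun h v hv => h hv⟩
      have : ρ g⁻¹ v ∈ T g N := by
        change ρ g (ρ g⁻¹ v) ∈ N
        rwa [Representation.self_inv_apply]
      have := h this
      change ρ g (ρ g⁻¹ v) ∈ N' at this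
      rwa [Representation.self_inv_apply] at this }

lemma mem_translateIso {ρ : Representation k G V} {H : Subgroup G} [H.Normal] {g : G}
    {N : Subrepresentation (res ρ H)} {v : V} : v ∈ translateIso ρ H g N ↔ ρ g v ∈ N := Iff.rfl

/-- The radical of the restriction to a normal subgroup is stable under the whole group. -/
lemma apply_mem_radical_res {ρ : Representation k G V} {H : Subgroup G} [H.Normal] (g : G) {v : V}
    (hv : v ∈ radical (res ρ H)) : ρ g v ∈ radical (res ρ H) := by
  rw [mem_radical] at hv ⊢
  intro N hN
  -- Translation by `g` permutes the maximal `H`-submodules.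
  exact mem_translateIso.1 (hv _ ((OrderIso.isCoatom_iff (translateIso ρ H g) N).2 hN))

/-- The kernel of an invariant linear form. -/
def kerForm (ρ : Representation k G V) (π : V →ₗ[k] k) (hπ : ∀ g v, π (ρ g v) = π v) :
    Subrepresentation ρ :=
  ⟨LinearMap.ker π, fun g v hv => by
    rw [LinearMap.mem_ker] at hv ⊢
    rw [hπ, hv]⟩

lemma mem_kerForm {ρ : Representation k G V} {π : V →ₗ[k] k} {hπ : ∀ g v, π (ρ g v) = π v}
    {v : V} : v ∈ kerForm ρ π hπ ↔ π v = 0 := Iff.rfl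

lemma isCoatom_kerForm {ρ : Representation k G V} {π : V →ₗ[k] k}
    (hπ : ∀ g v, π (ρ g v) = π v) (h0 : π ≠ 0) : IsCoatom (kerForm ρ π hπ) := by
  obtain ⟨u, hu⟩ : ∃ u, π u ≠ 0 := by
    by_contra! h
    exact h0 (LinearMap.ext h)
  refine ⟨fun h => hu (mem_kerForm.1 (h ▸ (show u ∈ (⊤ : Subrepresentation ρ) from trivial))),
    fun N hN => top_le_iff.1 fun v _ => ?_⟩
  obtain ⟨n, hn, hn'⟩ := SetLike.exists_of_lt hN
  have hn0 : π n ≠ 0 := fun h => hn' (mem_kerForm.2 h)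
  have h1 : v - (π v * (π n)⁻¹) • n ∈ N := hN.le (mem_kerForm.2 (by simp [hn0]))
  rw [← sub_add_cancel v ((π v * (π n)⁻¹) • n)]
  exact N.toSubmodule.add_mem h1 (N.toSubmodule.smul_mem _ hn)

/-- Let `H` be a normal subgroup whose index is invertible in `k`, and `π` an invariant linear form
such that `ker π` contains every proper subrepresentation. Then `ker π` is contained in the radical
of the restriction to `H`. -/
lemma kerForm_le_radical_res [Finite G] [FiniteDimensional k V] {ρ : Representation k G V}
    {H : Subgroup G} [H.Normal] (hH : (H.index : k) ≠ 0) {π : V →ₗ[k] k}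
    (hπ : ∀ g v, π (ρ g v) = π v) (h0 : π ≠ 0)
    (htop : ∀ (N : Subrepresentation ρ) (n : V), n ∈ N → π n ≠ 0 → N = ⊤) {v : V}
    (hv : π v = 0) : v ∈ radical (res ρ H) := by
  have hπH : ∀ (h : H) v, π (res ρ H h v) = π v := fun h v => hπ h v
  have hK := isCoatom_kerForm hπH h0
  -- Modulo the radical, `C` is a complement of `ker π`; hence `t ∈ C` with `π t ≠ 0` is `H`-fixed
  -- modulo the radical, because `h t - t` lies in both `C` and `ker π`.
  obtain ⟨C, hC1, hC2⟩ := exists_complement_mod_radical (radical_le hK)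
  obtain ⟨t, htC, ht⟩ : ∃ t ∈ C, π t ≠ 0 := by
    by_contra! h
    exact hK.1 (sup_eq_left.2 (show C ≤ kerForm _ π hπH from fun x hx => h x hx) ▸ hC2)
  have htH : ∀ h : H, ρ (h : G) t - t ∈ radical (res ρ H) := by
    intro h
    rw [← hC1]
    refine ⟨?_, C.toSubmodule.sub_mem (C.apply_mem_toSubmodule h htC) htC⟩
    exact mem_kerForm.2 (by rw [map_sub, hπ, sub_self])
  have := Fintype.ofFinite (G ⧸ H)
  -- The sum over `G/H` is `G`-fixed modulo the radical, and `π s = |G : H| π t` is nonzero.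
  let s : V := ∑ q : G ⧸ H, ρ q.out t
  have hs : π s ≠ 0 := by
    simp only [s, map_sum, hπ, Finset.sum_const, nsmul_eq_mul, Finset.card_univ]
    rw [← Nat.card_eq_fintype_card]
    exact mul_ne_zero hH ht
  let R := (radical (res ρ H)).toSubmodule
  have hsR : ∀ g : G, ρ g s - s ∈ R := by
    intro g
    have h1 : s = ∑ q : G ⧸ H, ρ (g • q).out t :=
      (Equiv.sum_comp (MulAction.toPerm g : Equiv.Perm (G ⧸ H)) fun q => ρ q.out t).symm
    have h2 : ρ g s - s = ∑ q : G ⧸ H, (ρ (g * q.out) t - ρ (g • q).out t) := by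
      rw [Finset.sum_sub_distrib, ← h1]
      simp [s]
    rw [h2]
    refine R.sum_mem fun q _ => ?_
    have hq : g • q = ((g * q.out : G) : G ⧸ H) := by
      conv_lhs => rw [← q.out_eq]
      rfl
    obtain ⟨h, hh⟩ := QuotientGroup.mk_out_eq_mul H (g * q.out)
    rw [hq, hh, map_mul ρ (g * q.out) (h : G), Module.End.mul_apply, ← map_sub, ← neg_sub, map_neg]
    exact R.neg_mem (apply_mem_radical_res _ (htH h))
  -- The space `R + k s` is `G`-stable and not inside `ker π`, so it is everything; as `π` kills `R`
  -- but not `s`, its kernel is exactly `R`.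
  let L : Subrepresentation ρ := ⟨R ⊔ Submodule.span k {s}, fun g v hv => by
    obtain ⟨a, ha, b, hb, rfl⟩ := Submodule.mem_sup.1 hv
    obtain ⟨c, rfl⟩ := Submodule.mem_span_singleton.1 hb
    refine Submodule.mem_sup.2 ⟨ρ g a + c • (ρ g s - s),
      R.add_mem (apply_mem_radical_res g ha) (R.smul_mem c (hsR g)), c • s, hb, ?_⟩
    rw [map_add, map_smul, smul_sub]
    abel⟩
  have hL : L = ⊤ := htop L s
    (Submodule.mem_sup_right (Submodule.mem_span_singleton_self s)) hs
  have hvL : v ∈ L := hL ▸ (show v ∈ (⊤ : Subrepresentation ρ) from trivial)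
  obtain ⟨a, ha, b, hb, rfl⟩ := Submodule.mem_sup.1 (show v ∈ R ⊔ Submodule.span k {s} from hvL)
  obtain ⟨c, rfl⟩ := Submodule.mem_span_singleton.1 hb
  have ha0 : π a = 0 := mem_kerForm.1 (radical_le hK ha)
  rw [map_add, ha0, zero_add, map_smul, smul_eq_mul] at hv
  rw [(mul_eq_zero.1 hv).resolve_right hs, zero_smul, add_zero]
  exact ha

/-- A representation whose radical contains the kernel of a nonzero invariant linear form is
indecomposable. -/
lemma isIndecomposable_of_kerForm_le_radical [FiniteDimensional k V] {ρ : Representation k G V}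
    {π : V →ₗ[k] k} (hπ : ∀ g v, π (ρ g v) = π v) (h0 : π ≠ 0)
    (hrad : ∀ v, π v = 0 → v ∈ radical ρ) : IsIndecomposable ρ := by
  have hK := isCoatom_kerForm hπ h0
  have := isCoatomic_subrepresentation ρ
  -- Every maximal submodule contains the radical, hence `ker π`, and so equals `ker π`.
  have key : ∀ N : Subrepresentation ρ, N ≠ ⊤ → N ≤ kerForm ρ π hπ := by
    intro N hN
    obtain ⟨N', hN', hle⟩ := (eq_top_or_exists_le_coatom N).resolve_left hN
    have h1 : kerForm ρ π hπ ≤ N' := fun v hv => radical_le hN' (hrad v hv)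
    exact hle.trans ((hK.le_iff_eq hN'.1).1 h1).le
  constructor
  · by_contra hV
    rw [not_nontrivial_iff_subsingleton] at hV
    exact h0 (LinearMap.ext fun v => by rw [Subsingleton.elim v 0, map_zero, map_zero])
  · intro W₁ W₂ hW
    by_cases h1 : W₁ = ⊤
    · right
      rw [← hW.inf_eq_bot, h1, top_inf_eq]
    by_cases h2 : W₂ = ⊤
    · left
      rw [← hW.inf_eq_bot, h2, inf_top_eq]
    exact absurd (top_le_iff.1 (hW.sup_eq_top ▸ sup_le (key _ h1) (key _ h2))) hK.1

/-! ### Transfer of indecomposability and the Brauer construction for a trivial action. -/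

/-- Indecomposability passes along a linear isomorphism `φ` from a representation of `H` to a
representation of `H'` if every element of `H` acts, through `φ`, as some element of `H'`. -/
lemma IsIndecomposable.of_linearEquiv {H H' W : Type*} [Group H] [Group H'] [AddCommGroup W]
    [Module k W] {ρ : Representation k H V} {σ : Representation k H' W} (h : IsIndecomposable ρ)
    (φ : V ≃ₗ[k] W) (hφ : ∀ x : H, ∃ y : H', ∀ v, φ (ρ x v) = σ y (φ v)) : IsIndecomposable σ := by
  have := h.1
  refine ⟨φ.symm.toEquiv.nontrivial, fun W₁ W₂ hW => ?_⟩
  -- Decompositions are pulled back from `σ` to `ρ`, which only needs each `x` in `H` to act as some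
  -- `y` in `H'`; no homomorphism between the groups is involved.
  let T (N : Subrepresentation σ) : Subrepresentation ρ :=
    ⟨N.toSubmodule.comap φ.toLinearMap, fun x v hv => by
      obtain ⟨y, hy⟩ := hφ x
      change φ (ρ x v) ∈ N.toSubmodule
      rw [hy]
      exact N.apply_mem_toSubmodule y hv⟩
  have hbot : ∀ N, T N = ⊥ → N = ⊥ := by
    intro N hN
    refine le_bot_iff.1 fun w hw => ?_
    have h1 : φ.symm w ∈ T N := by
      change φ (φ.symm w) ∈ N
      rwa [φ.apply_symm_apply]
    rw [hN] at h1
    have h2 : φ.symm w = 0 := h1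
    exact (φ.symm.map_eq_zero_iff).1 h2
  have hT : IsCompl (T W₁) (T W₂) := by
    refine IsCompl.of_eq (le_bot_iff.1 fun v hv => ?_) (top_le_iff.1 fun v _ => ?_)
    · have h1 : φ v ∈ W₁ ⊓ W₂ := hv
      rw [hW.inf_eq_bot] at h1
      exact (φ.map_eq_zero_iff).1 (show φ v = 0 from h1)
    · have h1 : φ v ∈ W₁ ⊔ W₂ := hW.sup_eq_top ▸ (show φ v ∈ (⊤ : Subrepresentation σ) from trivial)
      obtain ⟨a, ha, b, hb, hab⟩ := Submodule.mem_sup.1 h1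
      refine Submodule.mem_sup.2 ⟨φ.symm a, ?_, φ.symm b, ?_, ?_⟩
      · change φ (φ.symm a) ∈ W₁
        rwa [φ.apply_symm_apply]
      · change φ (φ.symm b) ∈ W₂
        rwa [φ.apply_symm_apply]
      · rw [← map_add, hab, φ.symm_apply_apply]
  exact (h.2 _ _ hT).imp (hbot _) (hbot _)

/-- If `Q` is a `p`-group acting trivially on `M` in characteristic `p`, then the relative traces
from proper subgroups to `Q` vanish. -/
lemma traceSum_eq_bot {p : ℕ} [Fact p.Prime] [CharP k p] [Finite G] {ρ : Representation k G V}
    {Q : Subgroup G} (hQ : IsPGroup p Q) (htriv : ∀ x ∈ Q, ∀ v, ρ x v = v) :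
    traceSum ρ Q = ⊥ := by
  refine le_bot_iff.1 (iSup₂_le fun K hK => ?_)
  rintro _ ⟨m, rfl⟩
  rw [Submodule.mem_bot]
  ext
  change ∑ᶠ h : Q ⧸ K.subgroupOf Q, ρ ((h.out : Q) : G) (m : V) = 0
  have := Fintype.ofFinite (Q ⧸ K.subgroupOf Q)
  obtain ⟨n, hn⟩ := hQ.index (K.subgroupOf Q)
  -- The index is a power of `p`, and the exponent is nonzero because `K` is proper in `Q`.
  have hn0 : n ≠ 0 := by
    rintro rfl
    rw [pow_zero, Subgroup.index_eq_one, Subgroup.subgroupOf_eq_top] at hn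
    exact hK.not_ge hn
  have hcard : (Fintype.card (Q ⧸ K.subgroupOf Q) : k) = 0 := by
    rw [← Nat.card_eq_fintype_card, ← Subgroup.index, hn, Nat.cast_pow, CharP.cast_eq_zero,
      zero_pow hn0]
  rw [finsum_eq_sum_of_fintype, Finset.sum_congr rfl fun h _ => htriv _ (h.out).2 m,
    Finset.sum_const, Finset.card_univ, ← Nat.cast_smul_eq_nsmul k, hcard, zero_smul]

/-- If the `p`-group `Q` acts trivially on `M`, then `M(Q)` is `M`. -/
def brauerEquiv {p : ℕ} [Fact p.Prime] [CharP k p] [Finite G] {ρ : Representation k G V}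
    {Q : Subgroup G} (hQ : IsPGroup p Q) (htriv : ∀ x ∈ Q, ∀ v, ρ x v = v) :
    V ≃ₗ[k] fixed ρ Q ⧸ traceSum ρ Q :=
  (LinearEquiv.ofTop (fixed ρ Q) (top_le_iff.1 fun v _ x => htriv x x.2 v)).symm ≪≫ₗ
    ((traceSum ρ Q).quotEquivOfEqBot (traceSum_eq_bot hQ htriv)).symm

/-- The isomorphism sends `v` to its own class, and the action on `M(Q)` is induced by `ρ`. -/
lemma brauerEquiv_apply {p : ℕ} [Fact p.Prime] [CharP k p] [Finite G] {ρ : Representation k G V}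
    {Q : Subgroup G} (hQ : IsPGroup p Q) (htriv : ∀ x ∈ Q, ∀ v, ρ x v = v)
    (n : Subgroup.normalizer (Q : Set G)) (v : V) :
    brauerEquiv hQ htriv (ρ (n : G) v) = brauer ρ Q n (brauerEquiv hQ htriv v) :=
  rfl

end ScottBrauer

end

/-! ### The main theorem. -/

theorem corollary2p2 {p : ℕ} [Fact p.Prime] {k : Type*} [Field k] [IsAlgClosed k] [CharP k p]
    {G : Type*} [Group G] [Finite G] (P : Subgroup G) (hP : IsPGroup p P) (hPn : P.Normal)
    (hp : ¬ p ∣ (P ⊔ Subgroup.centralizer (P : Set G)).index)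
    {V : Type*} [AddCommGroup V] [Module k V] (M : Representation k G V)
    (hM : ScottBrauer.IsScottModule M P) :
    ScottBrauer.IsBrauerIndecomposable M P := by
  have := ScottBrauer.finiteDimensional_of_isDirectSummand hM.isDirectSummand
  obtain ⟨π, h0, hπ⟩ := hM.trivialInTop.exists_linearForm
  have hind : ScottBrauer.IsIndecomposable
      (ScottBrauer.res M (P ⊔ Subgroup.centralizer (P : Set G))) :=
    ScottBrauer.isIndecomposable_of_kerForm_le_radical (π := π) (fun h v => hπ h v) h0
      fun v hv => ScottBrauer.kerForm_le_radical_res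
        (fun h => hp ((CharP.cast_eq_zero_iff k p _).1 h)) hπ h0
        (fun N _ hn hn0 => hM.eq_top_of_apply_ne_zero hπ N hn hn0) hv
  intro Q hQP
  have htriv : ∀ x ∈ P, ∀ v, M x v = v := fun x hx => hM.isDirectSummand.apply_eq_self hx
  refine Or.inl (hind.of_linearEquiv
    (ScottBrauer.brauerEquiv (hP.to_le hQP) fun x hx => htriv x (hQP hx)) ?_)
  rintro ⟨x, hx⟩
  -- The factor `a` in `P` acts trivially, so `a * c` acts as `c`, which centralizes `P` and hence
  -- `Q`.
  obtain ⟨a, ha, c, hc, rfl⟩ := Subgroup.mem_sup_of_normal_left.1 hx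
  have hcQ : c ∈ Subgroup.centralizer (Q : Set G) := Subgroup.centralizer_le hQP hc
  refine ⟨⟨c, Subgroup.mem_sup_right hcQ⟩, fun v => ?_⟩
  refine Eq.trans (congrArg _ ?_) (ScottBrauer.brauerEquiv_apply _ _ ⟨c, _⟩ v)
  change M (a * c) v = M c v
  rw [map_mul, Module.End.mul_apply, htriv a ha]
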